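/- **Minimum Principle, case $k>1$.** Let $n\ge 2$ and let $S^{n\times n}$ be the space of real symmetric $n\times n$ matrices. Let $H:\mathbb{R}^n\times S^{n\times n}\to\mathbb{R}$ satisfy: * (A) $H$ is continuous, $H(q,X)\le H(q,Y)$ whenever $X\le Y$, and $H(q,O)=0$ for all $q$; * (B) for some $k_1\ge 0$, $H(\theta q,X)=|\theta|^{k_1}H(q,X)$ for all $\theta\in\mathbb{R}$, and $H(q,\theta X)=\theta H(q,X)$ for all $\theta>0$; * (C) $\max_{|e|=1}H(e,-I)<0<\min_{|e|=1}H(e,I)$ and $\Lambda^{\sup}:=\sup_{\lambda\in\mathbb{R}}\max_{|e|=1}H(e,\lambda\, e\otimes e+I)<\infty$. No lower bound on $\Lambda^{\inf}:=\inf_{\lambda}\min_{|e|=1}H(e,\lambda\,e\otimes e-I)$ is assumed. Put $k=k_1+1$ and $\gamma=k+1$, assume $k>1$, and set $\gamma^*=\gamma/(\gamma-2)$ and, for $\sigma>1$, $\sigma^*=\sigma/(\sigma-1)$. Let $0<T<\infty$, let $\mathbb{R}^n_T=\mathbb{R}^n\times(0,T)$, let $\chi:(0,T)\to\mathbb{R}$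 be continuous and bounded, let $\sigma\ge 0$, let $h:\mathbb{R}^n\to\mathbb{R}$ be continuous with $\inf_{\mathbb{R}^n}h>-\infty$, and let $Z:\mathbb{R}\to[0,\infty)$ be continuous and non-increasing. Let $u:\mathbb{R}^n\times[0,T)\to\mathbb{R}$ be lower semicontinuous, with $u(x,0)\ge h(x)$ for all $x\in\mathbb{R}^n$, and a viscosity supersolution in $\mathbb{R}^n_T$ of $$H(Du,D^2u+Z(u)Du\otimes Du)+\chi(t)|Du|^\sigma-u_t\le 0$$ (with $|Du|^\sigma=1$ if $\sigma=0$). Fix $z\in\mathbb{R}^n$ and let $B^R_T=\{(x,t): |x-z|\le R,\ 0<t<T\}$. (a) Suppose that $0\le\sigma\le\gamma/2$ and $\sup_{B^R_T}(-u)=o(R^{\gamma^*})$ as $R\to\infty$. Then, for all $(x,t)\in\mathbb{R}^n_T$, $$u(x,t)\ \ge\ \begin{cases}\inf_{\mathbb{R}^n}h-t\,\sup_{0<s\le t}|\chi(s)|, & \sigma=0,\\[2pt] \inf_{\mathbb{R}^n}h, & 0<\sigma\le\gamma/2.\end{cases}$$ (b) Suppose that $\sigma>\gamma/2$ and $\sup_{B^R_T}(-u)=o(R^{\sigma^*})$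 as $R\to\infty$. Then $u(x,t)\ge\inf_{\mathbb{R}^n}h$ for all $(x,t)\in\mathbb{R}^n_T$. -/

import Mathlib

open Set Filter Topology Asymptotics

noncomputable section

namespace ParabolicPL

/-- The space `ℝⁿ` with its Euclidean norm. -/
abbrev E (n : ℕ) := EuclideanSpace ℝ (Fin n)

/-- Real `n × n` matrices; the symmetric ones are singled out by `Matrix.IsSymm`. -/
abbrev Mat (n : ℕ) := Matrix (Fin n) (Fin n) ℝ

/-- The rank one matrix `q ⊗ q`, with entries `qᵢ qⱼ`. -/
def tens {n : ℕ} (q : E n) : Mat n := Matrix.vecMulVec q.ofLp q.ofLp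

/-- The quadratic form `⟨X v, v⟩`. -/
def quad {n : ℕ} (X : Mat n) (v : E n) : ℝ := v.ofLp ⬝ᵥ (X.mulVec v.ofLp)

/-- Condition A: `H` is continuous on `ℝⁿ × Sⁿˣⁿ`, nondecreasing in the symmetric matrix variable,
and `H(q, O) = 0`. The values of `H` at non-symmetric matrices play no role. -/
structure CondA {n : ℕ} (H : E n → Mat n → ℝ) : Prop where
  cont : ContinuousOn (fun p : E n × Mat n => H p.1 p.2) {p | p.2.IsSymm}
  mono : ∀ (q : E n) (X Y : Mat n), X.IsSymm → Y.IsSymm → (Y - X).PosSemidef → H q X ≤ H q Y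
  zero : ∀ q : E n, H q 0 = 0

/-- Condition B: homogeneity of degree `k₁` in `q` and positive homogeneity of degree one in `X`. -/
structure CondB {n : ℕ} (H : E n → Mat n → ℝ) (k₁ : ℝ) : Prop where
  nonneg : 0 ≤ k₁
  homog_left : ∀ (θ : ℝ) (q : E n) (X : Mat n), X.IsSymm → H (θ • q) X = |θ| ^ k₁ * H q X
  homog_right : ∀ (θ : ℝ) (q : E n) (X : Mat n), 0 < θ → X.IsSymm → H q (θ • X) = θ * H q X

/-- `Λ_max(λ) = max_{|e| = 1} H(e, λ e ⊗ e + I)`. Under Condition A the supremum is over a compact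
set of values and is attained. -/
def LambdaMax {n : ℕ} (H : E n → Mat n → ℝ) (lam : ℝ) : ℝ :=
  sSup ((fun e : E n => H e (lam • tens e + 1)) '' Metric.sphere 0 1)

/-- Condition C: `max_{|e| = 1} H(e, -I) < 0 < min_{|e| = 1} H(e, I)` and
`Λ^sup = sup_λ Λ_max(λ) < ∞`. -/
structure CondC {n : ℕ} (H : E n → Mat n → ℝ) : Prop where
  max_neg : sSup ((fun e : E n => H e (-1)) '' Metric.sphere 0 1) < 0
  min_pos : 0 < sInf ((fun e : E n => H e 1) '' Metric.sphere 0 1)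
  lambdaSup_finite : BddAbove (range (LambdaMax H))

/-- The open strip `ℝⁿ × (0, T)`. -/
def strip (n : ℕ) (T : ℝ) : Set (E n × ℝ) := univ ×ˢ Ioo 0 T

/-- The cylinder `{(x, t) : |x - z| ≤ R, 0 < t < T}`. -/
def cyl {n : ℕ} (z : E n) (R T : ℝ) : Set (E n × ℝ) := Metric.closedBall z R ×ˢ Ioo 0 T

/-- `(a, p, X)` belongs to the parabolic subjet of second order of `u` at `(y, s)`: `X` is symmetric
and, as `(x, t) → (y, s)` in the strip,
`u(x,t) ≥ u(y,s) + a (t-s) + ⟨p, x-y⟩ + ½ ⟨X (x-y), x-y⟩ + o(|t-s| + |x-y|²)`. -/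
def IsParabolicSubjet {n : ℕ} (T : ℝ) (u : E n → ℝ → ℝ) (y : E n) (s : ℝ)
    (a : ℝ) (p : E n) (X : Mat n) : Prop :=
  X.IsSymm ∧ ∀ ε : ℝ, 0 < ε → ∀ᶠ P : E n × ℝ in 𝓝[strip n T] (y, s),
    u y s + a * (P.2 - s) + inner ℝ p (P.1 - y) + quad X (P.1 - y) / 2
      - ε * (|P.2 - s| + ‖P.1 - y‖ ^ 2) ≤ u P.1 P.2

/-- The operator `𝒫_σ = H(p, X + Z(r) p ⊗ p) + χ(t) |p|^σ - a`, where `r`, `a`, `p`, `X` stand for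
`u`, `u_t`, `Du`, `D²u`; for `σ = 0` the factor `|p|^σ` is `1`, also at `p = 0`. -/
def opP {n : ℕ} (H : E n → Mat n → ℝ) (Z χ : ℝ → ℝ) (σ : ℝ)
    (t r a : ℝ) (p : E n) (X : Mat n) : ℝ :=
  H p (X + Z r • tens p) + χ t * ‖p‖ ^ σ - a

/-- Viscosity supersolutions of `𝒫_σ(t, u, u_t, Du, D²u) ≤ 0` in `ℝⁿ × (0, T)`, in the sense of
the User's Guide of Crandall, Ishii and Lions: the inequality holds for every element of the
parabolic subjet at every point. (Equivalently, for the derivatives at `(y, s)` of every test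
function, `C²` in `x` and `C¹` in `t`, touching `u` from below at `(y, s)`.) -/
def IsViscSupersol {n : ℕ} (H : E n → Mat n → ℝ) (Z χ : ℝ → ℝ) (σ T : ℝ)
    (u : E n → ℝ → ℝ) : Prop :=
  ∀ (y : E n) (s : ℝ), s ∈ Ioo 0 T → ∀ (a : ℝ) (p : E n) (X : Mat n),
    IsParabolicSubjet T u y s a p X → opP H Z χ σ s (u y s) a p X ≤ 0

/-- `sup_{|x - z| ≤ R, 0 < t < T} (-u(x, t)) = o(R^β)` as `R → ∞`; in particular the suprema
are finite. -/
def NegGrowth {n : ℕ} (z : E n) (T : ℝ) (u : E n → ℝ → ℝ) (β : ℝ) : Prop :=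
  (∀ᶠ R : ℝ in atTop, BddAbove ((fun P : E n × ℝ => -u P.1 P.2) '' cyl z R T)) ∧
  (fun R : ℝ => sSup ((fun P : E n × ℝ => -u P.1 P.2) '' cyl z R T)) =o[atTop]
    fun R : ℝ => R ^ β

end ParabolicPL

end

namespace ParabolicPL

/-! The supersolution is compared with `barrier`, a strict classical subsolution whose spatial
growth is exactly the order that the negative part of `u` may not reach. Write w for `weight z x`
and b for b₀ e^{Lt}. If `u` lies below the barrier somewhere, the difference attains a negative
minimum at a positive time (`exists_barrier_min`), and the touching there gives a subjet element
with isotropic matrix -cI (`isParabolicSubjet_of_touch`).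

Monotonicity discards Z p ⊗ p, and homogeneity gives H(p, -cI) ≥ -cC|p|^k₁. The time derivative
contributes D + ε/(T' - t)² + L b w^α, which beats the diffusion and gradient terms provided (2α -
1)k₁ ≤ 2 and (2α - 1)σ ≤ 2α. The exponents γ* and σ*, taken as 2α, satisfy both. Since L does not
depend on b₀, the barrier can then be relaxed to m - Dt by letting ε = b₀ → 0. -/

/-! ### Second-order upper bounds for powers of the weight -/

lemma eventually_one_add_rpow_le {α : ℝ} (hα : 0 < α) :
    ∀ᶠ τ : ℝ in 𝓝 0, (1 + τ) ^ α ≤ 1 + α * τ + α ^ 2 * τ ^ 2 := by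
  set f : ℝ → ℝ := fun τ => 1 + α * τ + α ^ 2 * τ ^ 2 - (1 + τ) ^ α with hf
  have hpos : ∀ᶠ τ : ℝ in 𝓝 0, 1 + τ ≠ 0 := by
    filter_upwards [lt_mem_nhds (show (-1 : ℝ) < 0 by norm_num)] with τ hτ
    linarith
  have hd : ∀ τ : ℝ, 1 + τ ≠ 0 →
      HasDerivAt f (α + 2 * α ^ 2 * τ - α * (1 + τ) ^ (α - 1)) τ := by
    intro τ hτ
    have h1 : HasDerivAt (fun τ : ℝ => 1 + τ) 1 τ := (hasDerivAt_id τ).const_add 1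
    have h2 := h1.rpow_const (p := α) (Or.inl hτ)
    have h3 := ((((hasDerivAt_id τ).const_mul α).const_add 1).add
      (((hasDerivAt_id τ).pow 2).const_mul (α ^ 2))).sub h2
    refine (show HasDerivAt f _ τ from h3).congr_deriv ?_
    simp
    ring
  have hderiv : deriv f =ᶠ[𝓝 0] fun τ => α + 2 * α ^ 2 * τ - α * (1 + τ) ^ (α - 1) := by
    filter_upwards [hpos] with τ hτ using (hd τ hτ).deriv
  -- This equals α² + α > 0, so the second derivative test makes 0 a local minimum of `f`.
  have hdd : deriv (deriv f) 0 = 2 * α ^ 2 - α * (α - 1) := by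
    rw [hderiv.deriv_eq]
    have h1 : HasDerivAt (fun τ : ℝ => 1 + τ) 1 0 := (hasDerivAt_id 0).const_add 1
    have h2 := (h1.rpow_const (p := α - 1) (Or.inl (by norm_num))).const_mul α
    have h3 := (((hasDerivAt_id (0 : ℝ)).const_mul (2 * α ^ 2)).const_add α).sub h2
    refine (h3.congr_deriv ?_).deriv
    simp
  have hmin : IsLocalMin f 0 := by
    refine isLocalMin_of_deriv_deriv_pos ?_ ?_ (hd 0 (by norm_num)).continuousAt
    · rw [hdd]; nlinarith [sq_nonneg α]
    · rw [hderiv.eq_of_nhds]; simp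
  filter_upwards [hmin] with τ hτ
  simp only [hf] at hτ
  norm_num at hτ
  linarith

variable {n : ℕ}

/-- The smooth weight `1 + |x - z|²`. -/
noncomputable def weight (z x : E n) : ℝ := 1 + ‖x - z‖ ^ 2

lemma one_le_weight (z x : E n) : 1 ≤ weight z x := by
  unfold weight; nlinarith [sq_nonneg ‖x - z‖]

lemma weight_pos (z x : E n) : 0 < weight z x := zero_lt_one.trans_le (one_le_weight z x)

lemma continuous_weight (z : E n) : Continuous (weight z) := by
  unfold weight; fun_prop

lemma norm_sub_le_weight_rpow (z x : E n) : ‖x - z‖ ≤ weight z x ^ (1 / 2 : ℝ) := by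
  rw [← Real.sqrt_eq_rpow]
  apply Real.le_sqrt_of_sq_le
  unfold weight; linarith

lemma weight_eq (z y x : E n) :
    weight z x = weight z y + (2 * inner ℝ (y - z) (x - y) + ‖x - y‖ ^ 2) := by
  have : x - z = (y - z) + (x - y) := by abel
  unfold weight
  rw [this, norm_add_sq_real]
  ring

/-- Cauchy–Schwarz absorbs the rank-one part of the Hessian into a multiple of |x - y|², so `H` need
only be controlled at multiples of the identity. -/
lemma weight_rpow_le {α : ℝ} (hα : 0 < α) (z y : E n) :
    ∀ᶠ x in 𝓝 y, weight z x ^ α ≤ weight z y ^ α + weight z y ^ (α - 1) *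
      (2 * α * inner ℝ (y - z) (x - y) + (α + 8 * α ^ 2) * ‖x - y‖ ^ 2) := by
  have hw := weight_pos z y
  have hτ : Tendsto (fun x => (weight z x - weight z y) / weight z y) (𝓝 y) (𝓝 0) := by
    have : Continuous (fun x => (weight z x - weight z y) / weight z y) :=
      ((continuous_weight z).sub continuous_const).div_const _
    simpa using this.tendsto y
  filter_upwards [hτ.eventually (eventually_one_add_rpow_le hα),
    Metric.ball_mem_nhds y one_pos] with x hx hxy
  rw [Metric.mem_ball, dist_eq_norm] at hxy
  set q := weight z y with hq
  set i : ℝ := inner ℝ (y - z) (x - y) with hi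
  set d := ‖x - y‖ with hd
  have hd0 : 0 ≤ d := norm_nonneg _
  have hdiff : weight z x - q = 2 * i + d ^ 2 := by rw [weight_eq z y x]; ring
  have h1 : 1 + (weight z x - q) / q = weight z x / q := by field_simp; ring
  rw [h1, Real.div_rpow (weight_pos z x).le hw.le, div_le_iff₀ (Real.rpow_pos_of_pos hw α),
    hdiff] at hx
  refine hx.trans ?_
  have hpow : q ^ α = q ^ (α - 1) * q := by
    rw [← Real.rpow_add_one hw.ne']; ring_nf
  have hi2 : i ^ 2 ≤ (q - 1) * d ^ 2 := by
    have h2 := abs_real_inner_le_norm (y - z) (x - y)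
    have h3 : i ^ 2 ≤ (‖y - z‖ * d) ^ 2 := by
      rw [← sq_abs i]; exact pow_le_pow_left₀ (abs_nonneg _) h2 2
    have h4 : q - 1 = ‖y - z‖ ^ 2 := by rw [hq]; unfold weight; ring
    rw [h4]; linarith [mul_pow ‖y - z‖ d 2]
  have hsq : (2 * i + d ^ 2) ^ 2 ≤ 8 * q * d ^ 2 := by
    have h5 : d ^ 2 * d ^ 2 ≤ 1 * d ^ 2 :=
      mul_le_mul_of_nonneg_right (by nlinarith) (sq_nonneg d)
    nlinarith [sq_nonneg (2 * i - d ^ 2)]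
  have hkey : (1 + α * ((2 * i + d ^ 2) / q) + α ^ 2 * ((2 * i + d ^ 2) / q) ^ 2) * q
      ≤ q + (2 * α * i + (α + 8 * α ^ 2) * d ^ 2) := by
    have h6 : (2 * i + d ^ 2) ^ 2 / q ≤ 8 * d ^ 2 := by
      rw [div_le_iff₀ hw]; linarith
    have h7 : (1 + α * ((2 * i + d ^ 2) / q) + α ^ 2 * ((2 * i + d ^ 2) / q) ^ 2) * q
      = q + α * (2 * i + d ^ 2) + α ^ 2 * ((2 * i + d ^ 2) ^ 2 / q) := by field_simp
    rw [h7]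
    nlinarith [mul_le_mul_of_nonneg_left h6 (sq_nonneg α)]
  have hp : 0 < q ^ (α - 1) := Real.rpow_pos_of_pos hw _
  rw [hpow]
  nlinarith [mul_le_mul_of_nonneg_left hkey hp.le]

/-! ### Subjets from touching -/

lemma quad_smul_one (c : ℝ) (v : E n) : quad (c • (1 : Mat n)) v = c * ‖v‖ ^ 2 := by
  rw [EuclideanSpace.real_norm_sq_eq]
  simp [quad, Matrix.smul_mulVec, dotProduct, Finset.mul_sum, pow_two, mul_left_comm]

lemma isSymm_smul_one (c : ℝ) : (c • (1 : Mat n)).IsSymm := by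
  simp [Matrix.IsSymm]

/-- A function touched from below by `ψ(t) - b(t) (1 + |x - z|²)^α` has an isotropic element in its
parabolic subjet. -/
lemma isParabolicSubjet_of_touch {α T s b' ψ' : ℝ} (hα : 0 < α) {z y : E n} {b ψ : ℝ → ℝ}
    {u : E n → ℝ → ℝ} (hb : HasDerivAt b b' s) (hψ : HasDerivAt ψ ψ' s) (hbs : 0 < b s)
    (hmin : ∀ᶠ P : E n × ℝ in 𝓝[strip n T] (y, s),
      u y s - (ψ s - b s * weight z y ^ α) ≤ u P.1 P.2 - (ψ P.2 - b P.2 * weight z P.1 ^ α)) :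
    IsParabolicSubjet T u y s (ψ' - b' * weight z y ^ α)
      (-(2 * α * b s * weight z y ^ (α - 1)) • (y - z))
      (-(2 * b s * (α + 8 * α ^ 2) * weight z y ^ (α - 1)) • (1 : Mat n)) := by
  refine ⟨isSymm_smul_one _, fun ε hε => ?_⟩
  set W := weight z y ^ α
  set V := weight z y ^ (α - 1)
  set Q : E n → ℝ := fun x =>
    V * (2 * α * inner ℝ (y - z) (x - y) + (α + 8 * α ^ 2) * ‖x - y‖ ^ 2) with hQ
  have hle : 𝓝[strip n T] (y, s) ≤ 𝓝 (y, s) := nhdsWithin_le_nhds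
  have hfst : Tendsto (fun P : E n × ℝ => P.1) (𝓝[strip n T] (y, s)) (𝓝 y) :=
    (continuous_fst.tendsto (y, s)).mono_left hle
  have hsnd : Tendsto (fun P : E n × ℝ => P.2) (𝓝[strip n T] (y, s)) (𝓝 s) :=
    (continuous_snd.tendsto (y, s)).mono_left hle
  have hQc : Continuous Q := by simp only [hQ]; fun_prop
  have hQ0 : Tendsto (fun x => |Q x|) (𝓝 y) (𝓝 0) := by
    have := hQc.abs.tendsto y
    simpa [hQ] using this
  have hK : 0 < ε / (2 * (|b'| + 1)) := by positivity
  have hQe : ∀ᶠ x in 𝓝 y, |Q x| < ε / (2 * (|b'| + 1)) := hQ0.eventually (gt_mem_nhds hK)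
  have hθ : ∀ᶠ t in 𝓝 s, |(ψ t - W * b t) - (ψ s - W * b s) - (t - s) * (ψ' - W * b')|
      ≤ ε / 2 * |t - s| := by
    have := (hψ.sub (hb.const_mul W)).isLittleO.def (half_pos hε)
    simpa using this
  have hbe : ∀ᶠ t in 𝓝 s, |b t - b s - (t - s) * b'| ≤ 1 * |t - s| := by
    have := hb.isLittleO.def one_pos
    simpa using this
  have hbpos : ∀ᶠ t in 𝓝 s, 0 < b t := hb.continuousAt.eventually (lt_mem_nhds hbs)
  filter_upwards [hmin, hfst.eventually (weight_rpow_le hα z y), hfst.eventually hQe,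
    hsnd.eventually hθ, hsnd.eventually hbe, hsnd.eventually hbpos] with P h1 h2 h3 h4 h5 h6
  change weight z P.1 ^ α ≤ W + Q P.1 at h2
  have h7 : |b P.2 - b s| ≤ (|b'| + 1) * |P.2 - s| := by
    have : b P.2 - b s = (b P.2 - b s - (P.2 - s) * b') + (P.2 - s) * b' := by ring
    rw [this]
    refine (abs_add_le _ _).trans ?_
    rw [abs_mul]; linarith
  -- The mixed space-time error is O(|t - s|) · o(1); it takes one half of ε, the differentiability
  -- error in time the other.
  have h8 : (b P.2 - b s) * Q P.1 ≤ ε / 2 * |P.2 - s| := by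
    calc (b P.2 - b s) * Q P.1 ≤ |b P.2 - b s| * |Q P.1| := by
          rw [← abs_mul]; exact le_abs_self _
      _ ≤ ((|b'| + 1) * |P.2 - s|) * (ε / (2 * (|b'| + 1))) := by gcongr
      _ = ε / 2 * |P.2 - s| := by field_simp
  have h9 := (abs_le.1 h4).1
  have h10 := mul_le_mul_of_nonneg_left h2 h6.le
  have hQd : Q P.1 = V * (2 * α * inner ℝ (y - z) (P.1 - y) + (α + 8 * α ^ 2) * ‖P.1 - y‖ ^ 2) :=
    rfl
  have h11 : 0 ≤ ε * ‖P.1 - y‖ ^ 2 := by positivity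
  rw [quad_smul_one, real_inner_smul_left]
  have h12 : b s * Q P.1 = b s * (V * (2 * α * inner ℝ (y - z) (P.1 - y)
    + (α + 8 * α ^ 2) * ‖P.1 - y‖ ^ 2)) := by rw [hQd]
  nlinarith

/-! ### Lower bounds for the operator -/

/-- Homogeneity in both variables reduces the bound to H(e, -I) on the compact unit sphere. -/
lemma exists_lower_bound {H : E n → Mat n → ℝ} {k₁ : ℝ} (hk₁ : 0 < k₁) (hA : CondA H)
    (hB : CondB H k₁) :
    ∃ C : ℝ, 0 ≤ C ∧ ∀ (q : E n) (c : ℝ), 0 < c → -(c * C * ‖q‖ ^ k₁) ≤ H q (-c • (1 : Mat n)) := by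
  have hs : (-1 : Mat n).IsSymm := by simp [Matrix.IsSymm]
  have hcont : ContinuousOn (fun e : E n => H e (-1)) (Metric.sphere 0 1) := by
    have := hA.cont.comp (f := fun e : E n => (e, (-1 : Mat n))) (s := Metric.sphere 0 1)
      (by fun_prop) (fun e _ => hs)
    exact this
  obtain ⟨C, hC⟩ := (isCompact_sphere (0 : E n) 1).bddBelow_image hcont
  refine ⟨|C|, abs_nonneg _, fun q c hc => ?_⟩
  have h1 : H q (-c • (1 : Mat n)) = c * H q (-1) := by
    rw [← hB.homog_right c q (-1) hc hs]; simp
  rw [h1]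
  suffices -(|C| * ‖q‖ ^ k₁) ≤ H q (-1) by nlinarith [mul_le_mul_of_nonneg_left this hc.le]
  rcases eq_or_ne q 0 with rfl | hq
  -- Scaling by θ = 0 forces H(0, -I) = 0 because k₁ > 0.
  · have := hB.homog_left 0 (0 : E n) (-1) hs
    simp [Real.zero_rpow hk₁.ne'] at this ⊢
    simp [this]
  · have hq' : 0 < ‖q‖ := norm_pos_iff.2 hq
    have h2 := hB.homog_left ‖q‖ (‖q‖⁻¹ • q) (-1) hs
    rw [smul_inv_smul₀ hq'.ne', abs_of_pos hq'] at h2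
    rw [h2]
    have h3 : C ≤ H (‖q‖⁻¹ • q) (-1) := hC ⟨_, by simp [norm_smul, hq'.ne'], rfl⟩
    nlinarith [mul_le_mul_of_nonneg_left ((neg_abs_le C).trans h3) (Real.rpow_pos_of_pos hq' k₁).le]

lemma posSemidef_tens (q : E n) : (tens q).PosSemidef := by
  simpa [tens] using Matrix.posSemidef_vecMulVec_self_star q.ofLp

/-- Discarding the nonnegative term `Z(r) p ⊗ p` decreases the operator. -/
lemma le_add_smul_tens {H : E n → Mat n → ℝ} (hA : CondA H) {r : ℝ} (hr : 0 ≤ r) (q : E n)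
    {X : Mat n} (hX : X.IsSymm) : H q X ≤ H q (X + r • tens q) := by
  have hp := (posSemidef_tens q).smul hr
  have hs : (r • tens q).IsSymm := by simpa using hp.1
  exact hA.mono q _ _ hX (hX.add hs) (by simpa using hp)

/-! ### Growth condition and attainment of the minimum -/

lemma NegGrowth.exists_bound {z : E n} {T β : ℝ} {u : E n → ℝ → ℝ} (hg : NegGrowth z T u β)
    (R : ℝ) : ∃ K : ℝ, ∀ x, ‖x - z‖ ≤ R → ∀ t ∈ Ioo 0 T, -K ≤ u x t := by
  obtain ⟨R', ⟨K, hK⟩, hR⟩ := (hg.1.and (eventually_ge_atTop R)).exists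
  refine ⟨K, fun x hx t ht => ?_⟩
  have := hK ⟨(x, t), ⟨by simpa [dist_eq_norm] using hx.trans hR, ht⟩, rfl⟩
  simp only at this
  linarith

lemma NegGrowth.exists_radius {z : E n} {T β : ℝ} {u : E n → ℝ → ℝ} (hg : NegGrowth z T u β)
    {ε : ℝ} (hε : 0 < ε) :
    ∃ R₀ : ℝ, ∀ x, R₀ ≤ ‖x - z‖ → ∀ t ∈ Ioo 0 T, -(ε * ‖x - z‖ ^ β) ≤ u x t := by
  obtain ⟨R₀, hR₀⟩ := eventually_atTop.1 (hg.1.and (hg.2.def hε))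
  refine ⟨R₀, fun x hx t ht => ?_⟩
  obtain ⟨h1, h2⟩ := hR₀ _ hx
  have h3 : -u x t ≤ sSup ((fun P : E n × ℝ => -u P.1 P.2) '' cyl z ‖x - z‖ T) :=
    le_csSup h1 ⟨(x, t), ⟨by simp [dist_eq_norm], ht⟩, rfl⟩
  rw [Real.norm_eq_abs, Real.norm_of_nonneg (Real.rpow_nonneg (norm_nonneg _) _)] at h2
  linarith [le_abs_self (sSup ((fun P : E n × ℝ => -u P.1 P.2) '' cyl z ‖x - z‖ T))]

/-- The classical subsolution `m - D t - ε / (T - t) - b₀ e^{L t} (1 + |x - z|²)^α`. -/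
noncomputable def barrier (z : E n) (T m D ε b₀ L α : ℝ) (x : E n) (t : ℝ) : ℝ :=
  (m - D * t - ε / (T - t)) - b₀ * Real.exp (L * t) * weight z x ^ α

lemma norm_rpow_le_weight_rpow {α : ℝ} (hα : 0 < α) (z x : E n) :
    ‖x - z‖ ^ (2 * α) ≤ weight z x ^ α := by
  refine (Real.rpow_le_rpow (norm_nonneg _) (norm_sub_le_weight_rpow z x) (by positivity)).trans ?_
  rw [← Real.rpow_mul (weight_pos z x).le]
  apply le_of_eq; congr 1; ring

/-- The growth condition confines the points where `u` is below the barrier to a ball, and ε/(T' -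
t) keeps them away from T'. Lower semicontinuity gives a minimum on the resulting compact set; it is
not at time 0, where the barrier is at most m. -/
lemma exists_barrier_min {z : E n} {T T' m D ε b₀ L α : ℝ} {u : E n → ℝ → ℝ} (hTT : T' ≤ T)
    (hα : 0 < α) (hD : 0 ≤ D) (hε : 0 < ε) (hb₀ : 0 < b₀) (hL : 0 ≤ L)
    (hu : LowerSemicontinuousOn (fun P : E n × ℝ => u P.1 P.2) (univ ×ˢ Ico 0 T))
    (hinit : ∀ x, m ≤ u x 0) (hg : NegGrowth z T u (2 * α))
    {x₀ : E n} {t₀ : ℝ} (ht₀ : t₀ ∈ Ioo 0 T')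
    (hlt : u x₀ t₀ < barrier z T' m D ε b₀ L α x₀ t₀) :
    ∃ y, ∃ s ∈ Ioo 0 T', ∀ x, ∀ t ∈ Ioo 0 T',
      u y s - barrier z T' m D ε b₀ L α y s ≤ u x t - barrier z T' m D ε b₀ L α x t := by
  set φ := barrier z T' m D ε b₀ L α with hφ
  have hT' : 0 < T' := ht₀.1.trans ht₀.2
  have hφle : ∀ x, ∀ t ∈ Ico 0 T', φ x t ≤ |m| - ε / (T' - t) - b₀ * ‖x - z‖ ^ (2 * α) := by
    intro x t ht
    have h1 : b₀ * ‖x - z‖ ^ (2 * α) ≤ b₀ * Real.exp (L * t) * weight z x ^ α := by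
      have h2 : 1 ≤ Real.exp (L * t) := Real.one_le_exp (mul_nonneg hL ht.1)
      have h3 := norm_rpow_le_weight_rpow hα z x
      have h4 : 0 ≤ ‖x - z‖ ^ (2 * α) := by positivity
      calc b₀ * ‖x - z‖ ^ (2 * α) = b₀ * 1 * ‖x - z‖ ^ (2 * α) := by ring
        _ ≤ _ := by gcongr
    have h5 := mul_nonneg hD ht.1
    simp only [hφ, barrier]
    linarith [le_abs_self m]
  obtain ⟨R₀, hR₀⟩ := hg.exists_radius (half_pos hb₀)
  -- Beyond R, half of the barrier's decay dominates the negative part of `u` and the other half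
  -- dominates |m|.
  obtain ⟨R, hRm, hR0, hRR⟩ := (((tendsto_rpow_atTop (show 0 < 2 * α by positivity)).eventually_gt_atTop
    (|m| / (b₀ / 2))).and ((eventually_ge_atTop 0).and (eventually_ge_atTop R₀))).exists
  obtain ⟨K, hK⟩ := hg.exists_bound R
  set S := |K| + |m| + 1 with hS
  have hSpos : 0 < S := by positivity
  set T₁ := T' - ε / S with hT₁
  have hT₁lt : T₁ < T' := by rw [hT₁]; linarith [div_pos hε hSpos]
  have hout : ∀ x, ∀ t ∈ Ioo 0 T', u x t - φ x t ≤ 0 → ‖x - z‖ ≤ R ∧ t ≤ T₁ := by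
    intro x t ht hneg
    have htT : t ∈ Ioo 0 T := ⟨ht.1, ht.2.trans_le hTT⟩
    have h1 := hφle x t ⟨ht.1.le, ht.2⟩
    have h2 : 0 < T' - t := by linarith [ht.2]
    have hxR : ‖x - z‖ ≤ R := by
      by_contra! hx
      have h3 := hR₀ x (hRR.trans hx.le) t htT
      have h4 : R ^ (2 * α) ≤ ‖x - z‖ ^ (2 * α) := Real.rpow_le_rpow hR0 hx.le (by positivity)
      rw [div_lt_iff₀ (half_pos hb₀)] at hRm
      have h5 := div_pos hε h2
      nlinarith [mul_le_mul_of_nonneg_left h4 hb₀.le]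
    refine ⟨hxR, ?_⟩
    by_contra! ht1
    have h3 := hK x hxR t htT
    have h4 : S < ε / (T' - t) := by
      rw [lt_div_iff₀ h2, mul_comm, ← lt_div_iff₀ hSpos]
      rw [hT₁] at ht1; linarith
    have h5 : 0 ≤ b₀ * ‖x - z‖ ^ (2 * α) := by positivity
    linarith [le_abs_self K]
  have hcomp : IsCompact (Metric.closedBall z R ×ˢ Icc 0 T₁) :=
    (isCompact_closedBall z R).prod isCompact_Icc
  have hφc : ContinuousOn (fun P : E n × ℝ => -φ P.1 P.2) (Metric.closedBall z R ×ˢ Icc 0 T₁) := by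
    have h1 : ∀ P ∈ Metric.closedBall z R ×ˢ Icc 0 T₁, T' - P.2 ≠ 0 := fun P hP => by
      have := hP.2.2; linarith
    have h2 : Continuous fun P : E n × ℝ => weight z P.1 ^ α :=
      ((continuous_weight z).comp continuous_fst).rpow_const fun P => Or.inr hα.le
    simp only [hφ, barrier]
    refine ContinuousOn.neg (ContinuousOn.sub (ContinuousOn.sub (by fun_prop)
      (ContinuousOn.div (by fun_prop) (by fun_prop) h1)) (Continuous.continuousOn ?_))
    exact Continuous.mul (by fun_prop) h2
  have hlsc := (hu.mono (show Metric.closedBall z R ×ˢ Icc 0 T₁ ⊆ univ ×ˢ Ico 0 T from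
    fun P hP => ⟨trivial, hP.2.1, by linarith [hP.2.2]⟩)).add hφc.lowerSemicontinuousOn
  have hmem : ∀ x, ∀ t ∈ Ioo 0 T', u x t - φ x t ≤ 0 →
      (x, t) ∈ Metric.closedBall z R ×ˢ Icc 0 T₁ := fun x t ht h =>
    ⟨by simpa [dist_eq_norm] using (hout x t ht h).1, ht.1.le, (hout x t ht h).2⟩
  have hx₀ := hmem x₀ t₀ ht₀ (by linarith)
  obtain ⟨⟨y, s⟩, hys, hmin⟩ := hlsc.exists_isMinOn ⟨_, hx₀⟩ hcomp
  have hmin' : ∀ x t, (x, t) ∈ Metric.closedBall z R ×ˢ Icc 0 T₁ →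
      u y s - φ y s ≤ u x t - φ x t := fun x t hP => by
    have : u y s + -φ y s ≤ u x t + -φ x t := hmin hP
    linarith
  have hneg : u y s - φ y s < 0 := (hmin' _ _ hx₀).trans_lt (by linarith)
  have hsT : s < T' := hys.2.2.trans_lt hT₁lt
  have hs0 : 0 < s := by
    refine lt_of_le_of_ne hys.2.1 fun h0 => ?_
    have h1 : φ y 0 ≤ m := by
      simp only [hφ, barrier]
      have h2 : 0 ≤ ε / (T' - 0) := div_nonneg hε.le (by linarith)
      have h3 : 0 ≤ b₀ * Real.exp (L * 0) * weight z y ^ α :=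
        mul_nonneg (by positivity) (Real.rpow_nonneg (weight_pos z y).le _)
      linarith
    rw [← h0] at hneg
    linarith [hinit y]
  refine ⟨y, s, ⟨hs0, hsT⟩, fun x t ht => ?_⟩
  by_cases h : u x t - φ x t ≤ 0
  · exact hmin' x t (hmem x t ht h)
  · linarith

/-! ### Choice of the exponential rate -/

/-- The bound must be linear in b with L independent of b. For σ ≥ 1 this follows from b^σ ≤ b. For
0 < σ < 1 that fails: small gradients are paid for by η, and large ones satisfy g^σ ≤ δ^(σ-1) g. For
σ = 0 the constant A pays. -/
lemma exists_gradient_bound {σ α M A η : ℝ} (hσ : 0 ≤ σ) (hα : 1 / 2 < α)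
    (hσα : (2 * α - 1) * σ ≤ 2 * α) (hM : 0 ≤ M) (hA : 0 ≤ A) (hMA : σ = 0 → M ≤ A) (hη : 0 < η) :
    ∃ L : ℝ, 0 ≤ L ∧ ∀ b g w : ℝ, 0 < b → b ≤ 1 → 0 ≤ g → 1 ≤ w →
      g ≤ b * (2 * α) * w ^ (α - 1 / 2) → M * g ^ σ ≤ A + η + L * b * w ^ α := by
  have hα0 : 0 < α := by linarith
  rcases hσ.eq_or_lt with rfl | hσ0
  · refine ⟨0, le_rfl, fun b g w _ _ _ _ _ => ?_⟩
    have := hMA rfl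
    simp
    linarith
  rcases le_total σ 1 with hσ1 | hσ1
  · have hlim : Tendsto (fun x : ℝ => M * x ^ σ) (𝓝[>] 0) (𝓝 0) := by
      have h1 : Continuous fun x : ℝ => M * x ^ σ :=
        continuous_const.mul (Real.continuous_rpow_const hσ)
      simpa [Real.zero_rpow hσ0.ne'] using (h1.tendsto 0).mono_left nhdsWithin_le_nhds
    obtain ⟨δ, hδη, hδ⟩ := ((hlim.eventually (gt_mem_nhds hη)).and self_mem_nhdsWithin).exists
    have hδ : 0 < δ := hδ
    have hK : 0 ≤ M * δ ^ (σ - 1) := by positivity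
    refine ⟨M * δ ^ (σ - 1) * (2 * α), by positivity, fun b g w hb _ hg hw hgw => ?_⟩
    have hw0 : 0 < w := by linarith
    have hW : 0 < w ^ α := Real.rpow_pos_of_pos hw0 α
    rcases le_total g δ with hgδ | hgδ
    · have h1 : M * g ^ σ ≤ M * δ ^ σ := by gcongr
      have h2 : 0 ≤ M * δ ^ (σ - 1) * (2 * α) * b * w ^ α := by positivity
      linarith
    · have hg0 : 0 < g := hδ.trans_le hgδ
      have h1 : g ^ σ = g ^ (σ - 1) * g := by rw [← Real.rpow_add_one hg0.ne']; ring_nf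
      have h2 : g ^ (σ - 1) ≤ δ ^ (σ - 1) :=
        Real.rpow_le_rpow_of_nonpos hδ hgδ (by linarith)
      have h3 : w ^ (α - 1 / 2) ≤ w ^ α := Real.rpow_le_rpow_of_exponent_le hw (by linarith)
      have h4 : g ≤ b * (2 * α) * w ^ α := hgw.trans (by gcongr)
      calc M * g ^ σ = M * g ^ (σ - 1) * g := by rw [h1]; ring
        _ ≤ M * δ ^ (σ - 1) * (b * (2 * α) * w ^ α) := by gcongr
        _ = M * δ ^ (σ - 1) * (2 * α) * b * w ^ α := by ring
        _ ≤ _ := by linarith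
  · refine ⟨M * (2 * α) ^ σ, by positivity, fun b g w hb hb1 hg hw hgw => ?_⟩
    have hw0 : 0 < w := by linarith
    have h1 : g ^ σ ≤ (b * (2 * α) * w ^ (α - 1 / 2)) ^ σ := Real.rpow_le_rpow hg hgw hσ
    rw [Real.mul_rpow (by positivity) (by positivity), Real.mul_rpow hb.le (by positivity),
      ← Real.rpow_mul hw0.le] at h1
    have h2 : b ^ σ ≤ b := by
      simpa using Real.rpow_le_rpow_of_exponent_ge hb hb1 hσ1
    have h3 : w ^ ((α - 1 / 2) * σ) ≤ w ^ α :=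
      Real.rpow_le_rpow_of_exponent_le hw (by linarith)
    have h4 : g ^ σ ≤ b * (2 * α) ^ σ * w ^ α := h1.trans (by gcongr)
    calc M * g ^ σ ≤ M * (b * (2 * α) ^ σ * w ^ α) := by gcongr
      _ = M * (2 * α) ^ σ * b * w ^ α := by ring
      _ ≤ _ := by linarith

lemma exists_diffusion_bound {k₁ α C : ℝ} (hk₁ : 0 < k₁) (hα : 1 / 2 < α)
    (hkα : (2 * α - 1) * k₁ ≤ 2) (hC : 0 ≤ C) :
    ∃ L : ℝ, 0 ≤ L ∧ ∀ b g w : ℝ, 0 < b → b ≤ 1 → 0 ≤ g → 1 ≤ w →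
      g ≤ b * (2 * α) * w ^ (α - 1 / 2) →
      2 * b * (α + 8 * α ^ 2) * w ^ (α - 1) * C * g ^ k₁ ≤ L * b * w ^ α := by
  have hα0 : 0 < α := by linarith
  refine ⟨2 * (α + 8 * α ^ 2) * C * (2 * α) ^ k₁, by positivity, fun b g w hb hb1 hg hw hgw => ?_⟩
  have hw0 : 0 < w := by linarith
  have h1 : g ^ k₁ ≤ (b * (2 * α) * w ^ (α - 1 / 2)) ^ k₁ := Real.rpow_le_rpow hg hgw hk₁.le
  rw [Real.mul_rpow (by positivity) (by positivity), Real.mul_rpow hb.le (by positivity),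
    ← Real.rpow_mul hw0.le] at h1
  have h2 : b ^ k₁ ≤ 1 := Real.rpow_le_one hb.le hb1 hk₁.le
  have h3 : w ^ (α - 1) * w ^ ((α - 1 / 2) * k₁) ≤ w ^ α := by
    rw [← Real.rpow_add hw0]
    exact Real.rpow_le_rpow_of_exponent_le hw (by linarith)
  calc 2 * b * (α + 8 * α ^ 2) * w ^ (α - 1) * C * g ^ k₁
      ≤ 2 * b * (α + 8 * α ^ 2) * w ^ (α - 1) * C *
        (1 * (2 * α) ^ k₁ * w ^ ((α - 1 / 2) * k₁)) := by
        have : g ^ k₁ ≤ 1 * (2 * α) ^ k₁ * w ^ ((α - 1 / 2) * k₁) := h1.trans (by gcongr)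
        gcongr
    _ = 2 * (α + 8 * α ^ 2) * C * (2 * α) ^ k₁ * b *
        (w ^ (α - 1) * w ^ ((α - 1 / 2) * k₁)) := by ring
    _ ≤ _ := by gcongr

/-! ### Comparison with the barrier -/

/-- Minimum principle for supersolutions whose negative part is `o(R^{2α})`. -/
lemma le_of_isViscSupersol {H : E n → Mat n → ℝ} {k₁ : ℝ} (hk₁ : 0 < k₁) (hA : CondA H)
    (hB : CondB H k₁) {T T' : ℝ} (hTT : T' ≤ T) {Z χ : ℝ → ℝ} (hZ : ∀ r, 0 ≤ Z r)
    {σ α M A m : ℝ} (hσ : 0 ≤ σ) (hα : 1 / 2 < α) (hσα : (2 * α - 1) * σ ≤ 2 * α)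
    (hkα : (2 * α - 1) * k₁ ≤ 2) (hM : 0 ≤ M) (hχ : ∀ t ∈ Ioo 0 T', |χ t| ≤ M) (hA0 : 0 ≤ A)
    (hMA : σ = 0 → M ≤ A) {u : E n → ℝ → ℝ}
    (hu : LowerSemicontinuousOn (fun P : E n × ℝ => u P.1 P.2) (univ ×ˢ Ico 0 T))
    (hsuper : IsViscSupersol H Z χ σ T u) (hinit : ∀ x, m ≤ u x 0)
    {z : E n} (hg : NegGrowth z T u (2 * α)) (x₀ : E n) {t₀ : ℝ} (ht₀ : t₀ ∈ Ioo 0 T') :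
    m - A * t₀ ≤ u x₀ t₀ := by
  have hα0 : 0 < α := by linarith
  have hT' : 0 < T' := ht₀.1.trans ht₀.2
  obtain ⟨C, hC0, hC⟩ := exists_lower_bound hk₁ hA hB
  obtain ⟨L₁, hL₁, hdiff⟩ := exists_diffusion_bound hk₁ hα hkα hC0
  have hmain : ∀ η > 0, m - (A + η) * t₀ ≤ u x₀ t₀ := by
    intro η hη
    obtain ⟨L₂, hL₂, hgrad⟩ := exists_gradient_bound hσ hα hσα hM hA0 hMA hη
    set L := L₁ + L₂ with hL
    have hL0 : 0 ≤ L := add_nonneg hL₁ hL₂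
    -- The smallness of ε keeps b ≤ 1 up to time T', as the two absorption lemmas require.
    have hbar : ∀ ε : ℝ, 0 < ε → ε * Real.exp (L * T') ≤ 1 →
        barrier z T' m (A + η) ε ε L α x₀ t₀ ≤ u x₀ t₀ := by
      intro ε hε hε1
      by_contra! hlt
      obtain ⟨y, s, hs, hmin⟩ :=
        exists_barrier_min hTT hα0 (by positivity) hε hε hL0 hu hinit hg ht₀ hlt
      have hsT : s ∈ Ioo 0 T := ⟨hs.1, hs.2.trans_le hTT⟩
      have hs' : 0 < T' - s := by linarith [hs.2]
      have hb : HasDerivAt (fun t => ε * Real.exp (L * t)) (L * (ε * Real.exp (L * s))) s := by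
        refine ((((hasDerivAt_id s).const_mul L).exp).const_mul ε).congr_deriv ?_
        simp
        ring
      have hψ : HasDerivAt (fun t => m - (A + η) * t - ε / (T' - t))
          (-(A + η) - ε / (T' - s) ^ 2) s := by
        have h1 : HasDerivAt (fun t => T' - t) (-1) s := (hasDerivAt_id s).const_sub T'
        refine ((((hasDerivAt_id s).const_mul (A + η)).const_sub m).sub
          ((hasDerivAt_const s ε).div h1 hs'.ne')).congr_deriv ?_
        simp
      have hbs : 0 < ε * Real.exp (L * s) := by positivity
      have hb1 : ε * Real.exp (L * s) ≤ 1 := by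
        refine le_trans ?_ hε1
        have := hs.2.le
        gcongr
      have htouch : ∀ᶠ P : E n × ℝ in 𝓝[strip n T] (y, s),
          u y s - ((m - (A + η) * s - ε / (T' - s)) - ε * Real.exp (L * s) * weight z y ^ α)
          ≤ u P.1 P.2 - ((m - (A + η) * P.2 - ε / (T' - P.2))
            - ε * Real.exp (L * P.2) * weight z P.1 ^ α) := by
        have h1 : ∀ᶠ P : E n × ℝ in 𝓝 (y, s), P.2 ∈ Ioo 0 T' :=
          (continuous_snd.tendsto (y, s)).eventually (Ioo_mem_nhds hs.1 hs.2)
        filter_upwards [nhdsWithin_le_nhds h1] with P hP using hmin P.1 P.2 hP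
      have hsub := isParabolicSubjet_of_touch hα0 hb hψ hbs htouch
      have hle := hsuper y s hsT _ _ _ hsub
      set b := ε * Real.exp (L * s)
      set w := weight z y with hw
      have hw1 : 1 ≤ w := one_le_weight z y
      have hw0 : 0 < w := weight_pos z y
      set p : E n := -(2 * α * b * w ^ (α - 1)) • (y - z) with hp
      set c := 2 * b * (α + 8 * α ^ 2) * w ^ (α - 1) with hc
      have hc0 : 0 < c := by positivity
      have hpn : ‖p‖ ≤ b * (2 * α) * w ^ (α - 1 / 2) := by
        have h1 : 0 ≤ 2 * α * b * w ^ (α - 1) := by positivity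
        rw [hp, norm_smul, norm_neg, Real.norm_of_nonneg h1]
        calc 2 * α * b * w ^ (α - 1) * ‖y - z‖
            ≤ 2 * α * b * w ^ (α - 1) * w ^ (1 / 2 : ℝ) := by
              gcongr; exact norm_sub_le_weight_rpow z y
          _ = b * (2 * α) * (w ^ (α - 1) * w ^ (1 / 2 : ℝ)) := by ring
          _ = b * (2 * α) * w ^ (α - 1 / 2) := by
              rw [← Real.rpow_add hw0]; congr 2; ring
      have h1 := hdiff b ‖p‖ w hbs hb1 (norm_nonneg _) hw1 hpn
      have h2 := hgrad b ‖p‖ w hbs hb1 (norm_nonneg _) hw1 hpn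
      have h3 := hC p c hc0
      have h4 := le_add_smul_tens hA (hZ (u y s)) p (isSymm_smul_one (-c))
      have h5 : -(M * ‖p‖ ^ σ) ≤ χ s * ‖p‖ ^ σ := by
        have := mul_le_mul_of_nonneg_right (neg_le_of_abs_le (hχ s hs))
          (Real.rpow_nonneg (norm_nonneg p) σ)
        linarith
      have h6 : 0 < ε / (T' - s) ^ 2 := by positivity
      simp only [opP] at hle
      have h7 : L * b * w ^ α = L₁ * b * w ^ α + L₂ * b * w ^ α := by rw [hL]; ring
      linarith
    have hlim : Tendsto (fun ε : ℝ => barrier z T' m (A + η) ε ε L α x₀ t₀) (𝓝[>] 0)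
        (𝓝 (m - (A + η) * t₀)) := by
      have h1 : Continuous fun ε : ℝ => barrier z T' m (A + η) ε ε L α x₀ t₀ := by
        unfold barrier; fun_prop
      have h2 := (h1.tendsto 0).mono_left (nhdsWithin_le_nhds (s := Ioi 0))
      simpa [barrier] using h2
    refine le_of_tendsto hlim ?_
    have h3 : ∀ᶠ ε : ℝ in 𝓝[>] 0, ε ≤ (Real.exp (L * T'))⁻¹ :=
      nhdsWithin_le_nhds (Iic_mem_nhds (by positivity))
    filter_upwards [h3, self_mem_nhdsWithin] with ε hε1 hε0
    exact hbar ε hε0 ((le_inv_mul_iff₀ (Real.exp_pos _)).1 (by simpa using hε1) |>.trans_eq' (mul_comm _ _))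
  refine le_of_forall_pos_le_add fun δ hδ => ?_
  have h1 := hmain (δ / t₀) (div_pos hδ ht₀.1)
  have h2 : (A + δ / t₀) * t₀ = A * t₀ + δ := by field_simp [ht₀.1.ne']
  linarith

/-- A continuous bounded coefficient exceeds its running supremum by little shortly afterwards. -/
lemma exists_abs_le_sSup_add {χ : ℝ → ℝ} {T C t η : ℝ} (hχ : ContinuousOn χ (Ioo 0 T))
    (hC : ∀ s ∈ Ioo 0 T, |χ s| ≤ C) (ht : t ∈ Ioo 0 T) (hη : 0 < η) :
    ∃ T' ∈ Ioc t T, ∀ s ∈ Ioo 0 T', |χ s| ≤ sSup ((fun s => |χ s|) '' Ioc 0 t) + η := by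
  have hbdd : BddAbove ((fun s => |χ s|) '' Ioc 0 t) := by
    refine ⟨C, ?_⟩
    rintro _ ⟨s, hs, rfl⟩
    exact hC s ⟨hs.1, hs.2.trans_lt ht.2⟩
  have hsup : ∀ s ∈ Ioc 0 t, |χ s| ≤ sSup ((fun s => |χ s|) '' Ioc 0 t) :=
    fun s hs => le_csSup hbdd ⟨s, hs, rfl⟩
  have hcont : ContinuousAt (fun s => |χ s|) t := (hχ.continuousAt (Ioo_mem_nhds ht.1 ht.2)).abs
  have hev : ∀ᶠ s in 𝓝 t, |χ s| < |χ t| + η := hcont.eventually (gt_mem_nhds (by linarith))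
  obtain ⟨δ, hδ, hball⟩ := Metric.eventually_nhds_iff.1 hev
  refine ⟨min T (t + δ), ⟨lt_min ht.2 (by linarith), min_le_left _ _⟩, fun s hs => ?_⟩
  rcases le_or_gt s t with hst | hst
  · linarith [hsup s ⟨hs.1, hst⟩]
  · have h1 : s < t + δ := hs.2.trans_le (min_le_right _ _)
    have h2 := hball (y := s) (by rw [Real.dist_eq, abs_of_pos (by linarith)]; linarith)
    linarith [hsup t ⟨ht.1, le_rfl⟩]

end ParabolicPL

/-! ### The two growth regimes -/

theorem theorem2p7 (n : ℕ) (hn : 2 ≤ n)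
    (H : ParabolicPL.E n → ParabolicPL.Mat n → ℝ) (k₁ k γ : ℝ)
    (hk₁ : k = k₁ + 1) (hγ : γ = k + 1) (hk : 1 < k)
    (hA : ParabolicPL.CondA H) (hB : ParabolicPL.CondB H k₁) (hC : ParabolicPL.CondC H)
    (T : ℝ) (hT : 0 < T)
    (h : ParabolicPL.E n → ℝ) (hh : Continuous h) (hh_bdd : BddBelow (range h))
    (Z : ℝ → ℝ) (hZ : Continuous Z) (hZ_anti : Antitone Z) (hZ_nonneg : ∀ s, 0 ≤ Z s)
    (χ : ℝ → ℝ) (hχ : ContinuousOn χ (Ioo 0 T)) (hχ_bdd : ∃ C : ℝ, ∀ t ∈ Ioo 0 T, |χ t| ≤ C)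
    (σ : ℝ) (hσ : 0 ≤ σ)
    (u : ParabolicPL.E n → ℝ → ℝ)
    (hu : LowerSemicontinuousOn (fun P : ParabolicPL.E n × ℝ => u P.1 P.2) (univ ×ˢ Ico 0 T))
    (hu_super : ParabolicPL.IsViscSupersol H Z χ σ T u)
    (hu_init : ∀ x, h x ≤ u x 0)
    (z : ParabolicPL.E n) :
    (σ ≤ γ / 2 → ParabolicPL.NegGrowth z T u (γ / (γ - 2)) →
      (σ = 0 → ∀ (x : ParabolicPL.E n), ∀ t ∈ Ioo 0 T,
        (⨅ y, h y) - t * sSup ((fun s => |χ s|) '' Ioc 0 t) ≤ u x t) ∧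
      (0 < σ → ∀ (x : ParabolicPL.E n), ∀ t ∈ Ioo 0 T, (⨅ y, h y) ≤ u x t)) ∧
    (γ / 2 < σ → ParabolicPL.NegGrowth z T u (σ / (σ - 1)) →
      ∀ (x : ParabolicPL.E n), ∀ t ∈ Ioo 0 T, (⨅ y, h y) ≤ u x t) := by
  obtain ⟨C, hCb⟩ := hχ_bdd
  have hk₁0 : 0 < k₁ := by linarith
  have hγ' : γ = k₁ + 2 := by linarith
  have hinit : ∀ x, (⨅ y, h y) ≤ u x 0 := fun x => (ciInf_le hh_bdd x).trans (hu_init x)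
  refine ⟨fun hσγ hg => ?_, fun hσγ hg x t ht => ?_⟩
  · set α := γ / (γ - 2) / 2 with hα
    -- The diffusion constraint holds with equality here; σ ≤ γ/2 gives the gradient one.
    have hα2 : 2 * α = 1 + 2 / k₁ := by rw [hα, hγ', add_sub_cancel_right]; field_simp
    have hpos : 0 < 2 / k₁ := by positivity
    have hkα : (2 * α - 1) * k₁ ≤ 2 := by rw [hα2]; field_simp; linarith
    have hσα : (2 * α - 1) * σ ≤ 2 * α := by
      rw [hα2]
      calc (1 + 2 / k₁ - 1) * σ ≤ (1 + 2 / k₁ - 1) * (γ / 2) := by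
            apply mul_le_mul_of_nonneg_left hσγ; linarith
        _ = 1 + 2 / k₁ := by rw [hγ']; field_simp; ring
    have hg' : ParabolicPL.NegGrowth z T u (2 * α) := by
      rwa [show 2 * α = γ / (γ - 2) by rw [hα]; ring]
    refine ⟨fun hσ0 x t ht => ?_, fun hσ0 x t ht => ?_⟩
    · set S := sSup ((fun s => |χ s|) '' Ioc 0 t)
      have hS : 0 ≤ S := Real.sSup_nonneg (by rintro _ ⟨s, -, rfl⟩; exact abs_nonneg _)
      refine le_of_forall_pos_le_add fun δ hδ => ?_
      have hη : 0 < δ / t := div_pos hδ ht.1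
      -- The barrier needs a horizon strictly after t, at the cost of δ/t in the bound on χ.
      obtain ⟨T', hT', hM⟩ := ParabolicPL.exists_abs_le_sSup_add hχ hCb ht hη
      have := ParabolicPL.le_of_isViscSupersol hk₁0 hA hB hT'.2 hZ_nonneg hσ (by linarith) hσα hkα
        (by positivity) hM (by positivity) (fun _ => le_rfl) hu hu_super hinit hg' x
        ⟨ht.1, hT'.1⟩
      have h2 : (S + δ / t) * t = S * t + δ := by field_simp [ht.1.ne']
      linarith
    · have := ParabolicPL.le_of_isViscSupersol hk₁0 hA hB le_rfl hZ_nonneg hσ (by linarith) hσα hkα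
        (abs_nonneg C) (fun s hs => (hCb s hs).trans (le_abs_self C)) le_rfl
        (fun h0 => absurd h0 hσ0.ne') hu hu_super hinit hg' x ht
      simpa using this
  · have hσ1 : 0 < σ - 1 := by linarith
    set α := σ / (σ - 1) / 2 with hα
    -- Now the gradient constraint is the equality, and σ - 1 > k₁/2 gives the diffusion one.
    have hα2 : 2 * α = 1 + 1 / (σ - 1) := by rw [hα]; field_simp; ring
    have hpos : 0 < 1 / (σ - 1) := by positivity
    have hkα : (2 * α - 1) * k₁ ≤ 2 := by
      rw [hα2, add_sub_cancel_left, div_mul_eq_mul_div, div_le_iff₀ hσ1]; linarith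
    have hσα : (2 * α - 1) * σ ≤ 2 * α := by
      rw [hα2]; apply le_of_eq; field_simp; ring
    have hg' : ParabolicPL.NegGrowth z T u (2 * α) := by
      rwa [show 2 * α = σ / (σ - 1) by rw [hα]; ring]
    have := ParabolicPL.le_of_isViscSupersol hk₁0 hA hB le_rfl hZ_nonneg hσ (by linarith) hσα hkα
      (abs_nonneg C) (fun s hs => (hCb s hs).trans (le_abs_self C)) le_rfl
      (fun h0 => absurd h0 (by linarith)) hu hu_super hinit hg' x ht
    simpa using this
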